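/- Let $X$ be a locally compact Hausdorff space with Borel $\sigma$-algebra $\Sigma_X$, let $H$ be a complex Hilbert space, and let $I \trianglelefteq B(H)$ be a closed two-sided ideal. A POVM on $X$ is a map $A:\Sigma_X\to B(H)$ with $A(\emptyset)=0$, $A(\Delta)\ge 0$, which is countably additive in the weak operator topology. A full Borel asymptotic spectral measure (ASM) on $X$ is a family $\{A_\hbar\}_{\hbar\in(0,1]}$ of POVMs on $X$ such that $\limsup_{\hbar\to0}\|A_\hbar(X)\|\le 1$, such that $\hbar\mapsto A_\hbar(\Delta)$ is norm continuous on $(0,1]$ for every $\Delta\in\Sigma_X$, and such that $\lim_{\hbar\to 0}\|A_\hbar(\Delta_1\cap\Delta_2)-A_\hbar(\Delta_1)A_\hbar(\Delta_2)\|=0$ for all $\Delta_1,\Delta_2\in\Sigma_X$. It is locally $I$-valued if $A_\hbar(U)\in I$ for every $\hbar$ and every open $U\subseteq X$ with compact closure. A continuous compactification $\delta X$ of $X$ is given by its function algebra $C_\delta(X)\cong C(\delta X)$, a unital $C^*$-subalgebra of $C_b(X)$ (the bounded continuous complex functions) containing $C_0(X)$; then $C_0(X)$ is an ideal of $C_\delta(X)$.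 An asymptotic morphism between $C^*$-algebras $\mathcal A\to\mathcal B$ is a family of maps $\{Q_\hbar\}_{\hbar\in(0,1]}:\mathcal A\to\mathcal B$ such that for each $a \in \mathcal A$ the map $\hbar\mapsto Q_\hbar(a)$ is norm continuous and bounded, and such that for all $a,b\in\mathcal A$, $\lambda\in\mathbb C$, the norms of $Q_\hbar(a+b)-Q_\hbar(a)-Q_\hbar(b)$, $Q_\hbar(\lambda a)-\lambda Q_\hbar(a)$, $Q_\hbar(a^*)-Q_\hbar(a)^*$ and $Q_\hbar(ab)-Q_\hbar(a)Q_\hbar(b)$ tend to $0$ as $\hbar\to0$. If $\mathcal I\trianglelefteq\mathcal A$ and $\mathcal J\trianglelefteq\mathcal B$ are ideals and moreover $Q_\hbar(\mathcal I)\subseteq\mathcal J$ for every $\hbar$, it is called a relative asymptotic morphism $(\mathcal A,\mathcal I)\to(\mathcal B,\mathcal J)$. **Corollary 4.4.** Let $\{A_\hbar\}$ be a locally $I$-valued full Borel ASM on $X$, and let $\delta X$ be any continuous compactification of $X$. Then for every $\hbar\in(0,1]$ and $f\in C_\delta(X)$ there is a unique operator $$Q_\hbar(f)=\int_X f\,dA_\hbar\in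 B(H)$$ in the weak sense, that is, $\langle Q_\hbar(f)v,w\rangle=\int_X f(x)\,\langle dA_\hbar(x)v,w\rangle$ for all $v,w\in H$, where $f$ is integrable with respect to each of the complex measures $\langle A_\hbar(\cdot)v,w\rangle$. Each $Q_\hbar:C_\delta(X)\to B(H)$ is a positive linear map, and $\{Q_\hbar\}$ is a relative asymptotic morphism $$\{Q_\hbar\}:(C_\delta(X),C_0(X))\to(B(H),I).$$ -/

import Mathlib

open MeasureTheory Filter Topology
open scoped BoundedContinuousFunction ZeroAtInfty ENNReal ComplexOrder InnerProductSpace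

/-- The parameter space `(0, 1]` of the deformation parameter `ħ`. -/
abbrev HBar : Type := Set.Ioc (0 : ℝ) 1

/-- The filter `ħ → 0` on `(0, 1]`. -/
def classicalLimit : Filter HBar := comap ((↑) : HBar → ℝ) (𝓝 0)

/-! ### Positive operator-valued measures and their integrals -/

/-- A positive operator-valued measure on `X` with values in the bounded operators on `H`:
it vanishes on the empty set, has positive values on measurable sets, and is countably additive
in the weak operator topology. Following the convention for vector measures it is defined on all
sets, with value `0` on sets that are not measurable. -/
structure POVM (X : Type*) [MeasurableSpace X] (H : Type*) [NormedAddCommGroup H]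
    [InnerProductSpace ℂ H] where
  /-- the operator attached to a set -/
  toFun : Set X → (H →L[ℂ] H)
  map_empty : toFun ∅ = 0
  map_not_measurable : ∀ s : Set X, ¬ MeasurableSet s → toFun s = 0
  isPositive : ∀ s : Set X, MeasurableSet s → (toFun s).IsPositive
  hasSum_iUnion : ∀ f : ℕ → Set X, (∀ n, MeasurableSet (f n)) →
    Pairwise (Function.onFun Disjoint f) →
      ∀ v w : H, HasSum (fun n => ⟪w, toFun (f n) v⟫_ℂ) ⟪w, toFun (⋃ n, f n) v⟫_ℂ

instance {X : Type*} [MeasurableSpace X] {H : Type*} [NormedAddCommGroup H]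
    [InnerProductSpace ℂ H] : CoeFun (POVM X H) (fun _ => Set X → (H →L[ℂ] H)) :=
  ⟨POVM.toFun⟩

/-- The complex measure `Δ ↦ ⟨A(Δ) v, w⟩` (the inner product being linear in `v`). -/
noncomputable def POVM.complexMeasure {X : Type*} [MeasurableSpace X] {H : Type*} [NormedAddCommGroup H]
    [InnerProductSpace ℂ H] (A : POVM X H) (v w : H) : ComplexMeasure X where
  measureOf' s := ⟪w, A s v⟫_ℂ
  empty' := by simp [A.map_empty]
  not_measurable' s hs := by simp [A.map_not_measurable s hs]
  m_iUnion' f hf hd := A.hasSum_iUnion f hf hd v w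

/-- `T = ∫ f dA` in the weak sense: `⟨T v, w⟩ = ∫ f(x) ⟨dA(x) v, w⟩` for all `v, w`, where `f` is
required to be integrable for each of the complex measures `⟨A(·) v, w⟩`. -/
def POVM.IsIntegral {X : Type*} [MeasurableSpace X] {H : Type*} [NormedAddCommGroup H]
    [InnerProductSpace ℂ H] (A : POVM X H) (f : X → ℂ) (T : H →L[ℂ] H) : Prop :=
  ∀ v w : H, (A.complexMeasure v w).Integrable f ∧
    ⟪w, T v⟫_ℂ = (A.complexMeasure v w).integral f (ContinuousLinearMap.mul ℝ ℂ)

/-- `A` is locally `J`-valued: `A(U) ∈ J` for every open set `U` with compact closure. -/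
def POVM.IsLocallyValued {X : Type*} [TopologicalSpace X] [MeasurableSpace X] {H : Type*}
    [NormedAddCommGroup H] [InnerProductSpace ℂ H] (A : POVM X H) (J : Set (H →L[ℂ] H)) : Prop :=
  ∀ U : Set X, IsOpen U → IsCompact (closure U) → A U ∈ J

/-! ### Asymptotic spectral measures -/

/-- An asymptotic spectral measure on `X` with asymptotic carrier `E`. The upper limit is taken in
`[0, ∞]`, so that it is infinite for unbounded families. -/
structure IsAsymptoticSpectralMeasure {X : Type*} [MeasurableSpace X] {H : Type*}
    [NormedAddCommGroup H] [InnerProductSpace ℂ H] (E : Set (Set X)) (A : HBar → POVM X H) :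
    Prop where
  limsup_le : limsup (fun h => ‖A h Set.univ‖ₑ) classicalLimit ≤ 1
  continuous : ∀ Δ ∈ E, Continuous fun h => A h Δ
  projective : ∀ Δ₁ ∈ E, ∀ Δ₂ ∈ E,
    Tendsto (fun h => ‖A h (Δ₁ ∩ Δ₂) - A h Δ₁ * A h Δ₂‖) classicalLimit (𝓝 0)

/-- A full asymptotic spectral measure: every measurable set belongs to the carrier. -/
def IsFullAsymptoticSpectralMeasure {X : Type*} [MeasurableSpace X] {H : Type*}
    [NormedAddCommGroup H] [InnerProductSpace ℂ H] (A : HBar → POVM X H) : Prop :=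
  IsAsymptoticSpectralMeasure {Δ : Set X | MeasurableSet Δ} A

/-! ### Asymptotic morphisms -/

/-- An asymptotic morphism `𝓐 → 𝓑` (parametrized by `ħ ∈ (0, 1]`): a pointwise bounded and
continuous family of maps satisfying the axioms of a `*`-homomorphism in the limit `ħ → 0`. -/
structure IsAsymptoticMorphism {𝓐 𝓑 : Type*} [Ring 𝓐] [Module ℂ 𝓐] [Star 𝓐]
    [NormedRing 𝓑] [NormedSpace ℂ 𝓑] [Star 𝓑] (φ : HBar → 𝓐 → 𝓑) : Prop where
  continuous : ∀ a, Continuous fun h => φ h a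
  bounded : ∀ a, ∃ C : ℝ, ∀ h, ‖φ h a‖ ≤ C
  add : ∀ a b, Tendsto (fun h => ‖φ h (a + b) - (φ h a + φ h b)‖) classicalLimit (𝓝 0)
  smul : ∀ (c : ℂ) a, Tendsto (fun h => ‖φ h (c • a) - c • φ h a‖) classicalLimit (𝓝 0)
  star : ∀ a, Tendsto (fun h => ‖φ h (star a) - star (φ h a)‖) classicalLimit (𝓝 0)
  mul : ∀ a b, Tendsto (fun h => ‖φ h (a * b) - φ h a * φ h b‖) classicalLimit (𝓝 0)

/-- A relative asymptotic morphism `(𝓐, 𝓘) → (𝓑, 𝓙)`, for ideals `𝓘` of `𝓐` and `𝓙` of `𝓑`: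
an asymptotic morphism `𝓐 → 𝓑` each of whose members maps `𝓘` into `𝓙`. -/
structure IsRelativeAsymptoticMorphism {𝓐 𝓑 : Type*} [Ring 𝓐] [Module ℂ 𝓐] [Star 𝓐]
    [NormedRing 𝓑] [NormedSpace ℂ 𝓑] [Star 𝓑] (𝓘 : Ideal 𝓐) (𝓙 : Ideal 𝓑)
    (φ : HBar → 𝓐 → 𝓑) : Prop extends IsAsymptoticMorphism φ where
  mapsTo : ∀ h, ∀ a ∈ 𝓘, φ h a ∈ 𝓙

/-! ### Compactifications -/

/-- A continuous compactification `δX` of `X`, given through its function algebra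
`C_δ(X) ≅ C(δX)`: a unital `C*`-subalgebra of `C_b(X)` which contains `C_0(X)`. -/
structure ContinuousCompactification (X : Type*) [TopologicalSpace X] where
  /-- the algebra `C_δ(X)` -/
  algebra : StarSubalgebra ℂ (X →ᵇ ℂ)
  isClosed : IsClosed (algebra : Set (X →ᵇ ℂ))
  zeroAtInfty_mem : ∀ f : C₀(X, ℂ), f.toBCF ∈ algebra

/-- `C_0(X)` as an ideal of `C_δ(X)`. -/
def ContinuousCompactification.zeroAtInftyIdeal {X : Type*} [TopologicalSpace X]
    (δ : ContinuousCompactification X) : Ideal δ.algebra where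
  carrier := {f | Tendsto (f : X →ᵇ ℂ) (cocompact X) (𝓝 0)}
  zero_mem' := tendsto_const_nhds
  add_mem' {f g} hf hg := by
    have h : Tendsto (fun x => (f : X →ᵇ ℂ) x + (g : X →ᵇ ℂ) x) (cocompact X) (𝓝 (0 + 0)) :=
      Tendsto.add hf hg
    rw [add_zero] at h
    exact h
  smul_mem' c f hf := by
    have hb : IsBoundedUnder (· ≤ ·) (cocompact X) (norm ∘ fun x => (c : X →ᵇ ℂ) x) :=
      isBoundedUnder_of ⟨‖(c : X →ᵇ ℂ)‖, fun x => (c : X →ᵇ ℂ).norm_coe_le_norm x⟩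
    exact isBoundedUnder_le_mul_tendsto_zero hb hf

/-- The compactification given by a dense embedding `ι : X → Y` of a locally compact space into a
compact Hausdorff space: here `C_δ(X)` consists of the restrictions to `X` of the continuous
functions on `Y`. -/
def ContinuousCompactification.ofIsDenseEmbedding {X Y : Type*} [TopologicalSpace X]
    [LocallyCompactSpace X] [TopologicalSpace Y] [CompactSpace Y] [T2Space Y] (ι : X → Y)
    (hι : IsDenseEmbedding ι) : ContinuousCompactification X where
  algebra :=
    { carrier := {f | ∃ g : C(Y, ℂ), ∀ x, g (ι x) = f x}
      mul_mem' := by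
        rintro _ _ ⟨a, ha⟩ ⟨b, hb⟩
        exact ⟨a * b, fun x => by simp [ha, hb]⟩
      add_mem' := by
        rintro _ _ ⟨a, ha⟩ ⟨b, hb⟩
        exact ⟨a + b, fun x => by simp [ha, hb]⟩
      algebraMap_mem' := fun r => ⟨algebraMap ℂ C(Y, ℂ) r, fun x => by simp⟩
      star_mem' := by
        rintro _ ⟨a, ha⟩
        exact ⟨star a, fun x => by simp [ha]⟩ }
  isClosed := by
    let Φ : C(Y, ℂ) → (X →ᵇ ℂ) := fun g =>
      (BoundedContinuousFunction.mkOfCompact g).compContinuous ⟨ι, hι.continuous⟩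
    have hΦ : Isometry Φ := by
      refine Isometry.of_dist_eq fun a b => le_antisymm ?_ ?_
      · refine (BoundedContinuousFunction.dist_le dist_nonneg).2 fun x => ?_
        exact ContinuousMap.dist_apply_le_dist (ι x)
      · refine (ContinuousMap.dist_le dist_nonneg).2 fun y => ?_
        refine hι.dense.induction_on (p := fun y => dist (a y) (b y) ≤ dist (Φ a) (Φ b)) y
          (isClosed_le (by fun_prop) continuous_const) fun x => ?_
        exact BoundedContinuousFunction.dist_coe_le_dist (f := Φ a) (g := Φ b) x
    have hr := hΦ.isClosedEmbedding.isClosed_range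
    convert hr using 1
    ext f
    constructor
    · rintro ⟨g, hg⟩
      exact ⟨g, BoundedContinuousFunction.ext hg⟩
    · rintro ⟨g, rfl⟩
      exact ⟨g, fun x => rfl⟩
  zeroAtInfty_mem := by
    have hopen : IsOpen (Set.range ι) := by
      rw [isOpen_iff_mem_nhds]
      rintro _ ⟨x, rfl⟩
      obtain ⟨K, hK, hxK⟩ := exists_compact_mem_nhds x
      rw [hι.isInducing.nhds_eq_comap, mem_comap] at hxK
      obtain ⟨V, hV, hVK⟩ := hxK
      obtain ⟨W, hWV, hW, hxW⟩ := mem_nhds_iff.1 hV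
      refine mem_of_superset (hW.mem_nhds hxW) fun y hy => ?_
      have h1 : y ∈ closure (W ∩ Set.range ι) := hι.dense.open_subset_closure_inter hW hy
      have h2 : W ∩ Set.range ι ⊆ ι '' K := by
        rintro _ ⟨hz, z, rfl⟩
        exact ⟨z, hVK (hWV hz), rfl⟩
      have h3 := closure_minimal h2 (hK.image hι.continuous).isClosed h1
      exact Set.image_subset_range _ _ h3
    have hemb : IsOpenEmbedding ι := ⟨hι.isEmbedding, hopen⟩
    intro f
    have hf0 : Tendsto f (cocompact X) (𝓝 0) := f.zero_at_infty'
    refine ⟨⟨Function.extend ι f 0, ?_⟩, fun x => hι.injective.extend_apply _ _ x⟩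
    rw [continuous_iff_continuousAt]
    intro y
    by_cases hy : y ∈ Set.range ι
    · obtain ⟨x, rfl⟩ := hy
      rw [← hemb.continuousAt_iff]
      have : Function.extend ι f 0 ∘ ι = f := funext fun z => hι.injective.extend_apply _ _ z
      rw [this]
      exact f.continuous.continuousAt
    · have h0 : Function.extend ι f 0 y = 0 := Function.extend_apply' _ _ _ hy
      rw [ContinuousAt, h0]
      refine tendsto_def.2 fun U hU => ?_
      obtain ⟨K, hK, hKU⟩ := mem_cocompact.1 (hf0 hU)
      have hyK : y ∉ ι '' K := fun h => hy (Set.image_subset_range _ _ h)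
      refine mem_of_superset ((hK.image hι.continuous).isClosed.isOpen_compl.mem_nhds hyK) ?_
      intro z hz
      by_cases hzr : z ∈ Set.range ι
      · obtain ⟨x, rfl⟩ := hzr
        change Function.extend ι f 0 (ι x) ∈ U
        rw [hι.injective.extend_apply]
        exact hKU fun hx => hz ⟨x, hx, rfl⟩
      · change Function.extend ι f 0 z ∈ U
        rw [Function.extend_apply' _ _ _ hzr]
        exact mem_of_mem_nhds hU

/-! The integral is built for all bounded measurable functions, where every claim can be tested on
indicators and carried to linear combinations and uniform limits. For a positive operator,
Cauchy-Schwarz and the inequality of means bound off-diagonal matrix entries by diagonal ones.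
Summed over a partition, this bounds the variation of `⟨A(·)v, w⟩` by `‖A(X)‖ (‖v‖² + ‖w‖²) / 2`
(`POVM.variation_univ_le`). Hence `‖∫ f dA‖ ≤ sup |f| · ‖A(X)‖` (`POVM.IsIntegral.norm_le`):
integrals of simple approximations are Cauchy in norm, and their limit is the weak integral of `f`.
Since `‖A_ħ(X)‖` is bounded in `ħ`, the approximation is uniform in `ħ`, so continuity and
asymptotic multiplicativity pass from indicators to all functions. Linearity and compatibility with
adjoints hold exactly for each `ħ`. For `f` in `C_0(X)` the approximations need only level sets at
positive levels. These are open with compact closure, so their operators lie in `I`, and closedness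
of `I` does the rest. -/

/-! ### Positive operators -/

section PositiveOperators

variable {H : Type*} [NormedAddCommGroup H] [InnerProductSpace ℂ H]

/-- The Cauchy-Schwarz inequality for the sesquilinear form of a positive operator, combined with
the inequality between the geometric and the arithmetic mean. -/
theorem ContinuousLinearMap.IsPositive.norm_inner_le [CompleteSpace H] {T : H →L[ℂ] H}
    (hT : T.IsPositive) (v w : H) :
    ‖⟪w, T v⟫_ℂ‖ ≤ ((⟪v, T v⟫_ℂ).re + (⟪w, T w⟫_ℂ).re) / 2 := by
  -- Writing `T = S* S` turns the form into `⟨S w, S v⟩`, so ordinary Cauchy-Schwarz applies.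
  obtain ⟨S, rfl⟩ := CStarAlgebra.nonneg_iff_eq_star_mul_self.1
    ((ContinuousLinearMap.nonneg_iff_isPositive T).2 hT)
  have key (a b : H) : ⟪a, (star S * S) b⟫_ℂ = ⟪S a, S b⟫_ℂ := by
    simp [ContinuousLinearMap.star_eq_adjoint, ContinuousLinearMap.adjoint_inner_right]
  have hsq (a : H) : (⟪S a, S a⟫_ℂ).re = ‖S a‖ ^ 2 := by
    rw [inner_self_eq_norm_sq_to_K]; norm_cast
  rw [key, key, key, hsq, hsq]
  have := norm_inner_le_norm (𝕜 := ℂ) (S w) (S v)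
  nlinarith [sq_nonneg (‖S w‖ - ‖S v‖)]

/-- Over `ℂ` the quadratic form detects symmetry too: `0 ≤ z` in the complex order includes that `z`
is real. -/
theorem ContinuousLinearMap.isClosed_setOf_isPositive :
    IsClosed {T : H →L[ℂ] H | T.IsPositive} := by
  have h : {T : H →L[ℂ] H | T.IsPositive} = ⋂ x : H, {T | 0 ≤ ⟪T x, x⟫_ℂ} := by
    ext T
    have h0 (z : ℂ) : 0 ≤ z ↔ ((z.re : ℝ) : ℂ) = z ∧ 0 ≤ z.re := by
      simp [Complex.le_def, Complex.ext_iff, eq_comm, and_comm]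
    simp [ContinuousLinearMap.isPositive_iff_complex, h0]
  rw [h]
  exact isClosed_iInter fun x => isClosed_le continuous_const (by fun_prop)

theorem ContinuousLinearMap.opNorm_le_of_norm_inner_le {T : H →L[ℂ] H} {C : ℝ} (hC : 0 ≤ C)
    (h : ∀ v w, ‖⟪w, T v⟫_ℂ‖ ≤ C * ((‖v‖ ^ 2 + ‖w‖ ^ 2) / 2)) : ‖T‖ ≤ C := by
  refine T.opNorm_le_bound hC fun v => ?_
  rcases eq_or_ne (T v) 0 with hT | hT
  · rw [hT, norm_zero]; positivity
  have hT' : 0 < ‖T v‖ := norm_pos_iff.2 hT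
  have hv : 0 < ‖v‖ := norm_pos_iff.2 fun h => hT (by simp [h])
  -- This test vector has the norm of `v`, so the mean of the squares is `‖v‖²` and no constant is
  -- lost.
  have h1 := h v (((‖v‖ / ‖T v‖ : ℝ) : ℂ) • T v)
  rw [norm_smul, inner_smul_left, norm_mul, inner_self_eq_norm_sq_to_K] at h1
  simp only [Complex.conj_ofReal, norm_pow, Complex.norm_real, norm_div, norm_norm,
    Complex.coe_algebraMap] at h1
  rw [div_mul_cancel₀ _ hT'.ne', show ‖v‖ / ‖T v‖ * ‖T v‖ ^ 2 = ‖v‖ * ‖T v‖ by field_simp] at h1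
  refine le_of_mul_le_mul_left ?_ hv
  linarith

end PositiveOperators

/-! ### Bounded measurable functions -/

/-- The bounded measurable complex functions. -/
def boundedMeasurable (X : Type*) [MeasurableSpace X] : Subalgebra ℂ (X → ℂ) where
  carrier := {f | Measurable f ∧ ∃ C, ∀ x, ‖f x‖ ≤ C}
  mul_mem' := by
    rintro f g ⟨hf, C, hC⟩ ⟨hg, D, hD⟩
    refine ⟨hf.mul hg, C * D, fun x => ?_⟩
    rw [Pi.mul_apply, norm_mul]
    exact mul_le_mul (hC x) (hD x) (norm_nonneg _) ((norm_nonneg _).trans (hC x))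
  add_mem' := by
    rintro f g ⟨hf, C, hC⟩ ⟨hg, D, hD⟩
    exact ⟨hf.add hg, C + D, fun x => (norm_add_le _ _).trans (add_le_add (hC x) (hD x))⟩
  algebraMap_mem' c := ⟨measurable_const, ‖c‖, fun _ => le_rfl⟩

theorem BoundedContinuousFunction.mem_boundedMeasurable {X : Type*} [TopologicalSpace X]
    [MeasurableSpace X] [OpensMeasurableSpace X] (f : X →ᵇ ℂ) : ⇑f ∈ boundedMeasurable X :=
  ⟨f.continuous.measurable, ‖f‖, f.norm_coe_le_norm⟩

theorem star_mem_boundedMeasurable {X : Type*} [MeasurableSpace X] {f : X → ℂ}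
    (hf : f ∈ boundedMeasurable X) : star f ∈ boundedMeasurable X := by
  obtain ⟨hm, C, hC⟩ := hf
  exact ⟨Complex.continuous_conj.measurable.comp hm, C, fun x => by simpa using hC x⟩

theorem indicator_mem_boundedMeasurable {X : Type*} [MeasurableSpace X] {s : Set X}
    (hs : MeasurableSet s) : s.indicator (1 : X → ℂ) ∈ boundedMeasurable X := by
  refine ⟨measurable_one.indicator hs, 1, fun x => ?_⟩
  by_cases hx : x ∈ s <;> simp [hx]

/-- A bounded nonnegative function is uniformly approximated by the weighted sum of the indicators
of its upper level sets. -/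
theorem exists_abs_sub_sum_indicator_le {X : Type*} {f : X → ℝ} (hf : ∀ x, 0 ≤ f x) {M : ℝ}
    (hM : ∀ x, f x ≤ M) {ε : ℝ} (hε : 0 < ε) :
    ∃ N : ℕ, ∀ x, |f x - ∑ k ∈ Finset.range N,
      ε * {y | ε * (k + 1 : ℕ) < f y}.indicator 1 x| ≤ ε := by
  -- The sum counts the levels `ε, 2ε, …, Nε` below `f x`. Once `f x` exceeds `ε * N` it saturates
  -- at `ε * N`, which is what the next induction step needs. Level `0` is omitted, so all level
  -- sets have positive level.
  have key (N : ℕ) (x : X) : (f x ≤ ε * N →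
      |f x - ∑ k ∈ Finset.range N, ε * {y | ε * (k + 1 : ℕ) < f y}.indicator 1 x| ≤ ε) ∧
      (ε * N < f x →
        ∑ k ∈ Finset.range N, ε * {y | ε * (k + 1 : ℕ) < f y}.indicator 1 x = ε * N) := by
    induction N with
    | zero =>
      refine ⟨fun h => ?_, fun _ => by simp⟩
      have : f x = 0 := le_antisymm (by simpa using h) (hf x)
      simp [this, hε.le]
    | succ N ih =>
      obtain ⟨ih1, ih2⟩ := ih
      rw [Finset.sum_range_succ]
      refine ⟨fun h => ?_, fun h => ?_⟩
      · rw [Set.indicator_of_notMem (by simpa using h), mul_zero, add_zero]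
        rcases le_or_gt (f x) (ε * N) with h' | h'
        · exact ih1 h'
        · rw [ih2 h', abs_of_nonneg (by linarith)]
          push_cast at h
          linarith
      · have h' : ε * N < f x := by
          push_cast at h
          linarith
        rw [Set.indicator_of_mem (by simpa using h), ih2 h']
        push_cast
        simp [mul_add]
  obtain ⟨N, hN⟩ := exists_nat_ge (M / ε)
  refine ⟨N, fun x => (key N x).1 ((hM x).trans ?_)⟩
  rwa [div_le_iff₀' hε] at hN

theorem Complex.ofReal_indicator_one {X : Type*} (s : Set X) (x : X) :
    ((s.indicator (1 : X → ℝ) x : ℝ) : ℂ) = s.indicator 1 x := by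
  by_cases hx : x ∈ s <;> simp [hx]

theorem exists_mem_span_indicator_norm_sub_le_of_nonneg {X : Type*} {𝓢 : Set (Set X)} {f : X → ℝ}
    (hf : ∀ x, 0 ≤ f x) {M : ℝ} (hM : ∀ x, f x ≤ M) (h𝓢 : ∀ c, 0 < c → {x | c < f x} ∈ 𝓢) {ε : ℝ}
    (hε : 0 < ε) :
    ∃ g ∈ Submodule.span ℂ ((fun s : Set X => s.indicator (1 : X → ℂ)) '' 𝓢),
      ∀ x, ‖(f x : ℂ) - g x‖ ≤ ε := by
  obtain ⟨N, hN⟩ := exists_abs_sub_sum_indicator_le hf hM hε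
  refine ⟨∑ k ∈ Finset.range N, (ε : ℂ) • {y | ε * (k + 1 : ℕ) < f y}.indicator (1 : X → ℂ),
    Submodule.sum_mem _ fun k _ => Submodule.smul_mem _ _ (Submodule.subset_span
      ⟨_, h𝓢 _ (by positivity), rfl⟩), fun x => ?_⟩
  refine le_of_eq_of_le ?_ (hN x)
  rw [← Real.norm_eq_abs, ← Complex.norm_real]
  congr 1
  rw [Complex.ofReal_sub, Complex.ofReal_sum, Finset.sum_apply]
  congr 1
  refine Finset.sum_congr rfl fun k _ => ?_
  rw [Complex.ofReal_mul, Complex.ofReal_indicator_one]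
  rfl

/-- A bounded complex function is a uniform limit of linear combinations of indicators of the upper
level sets, at positive levels, of the positive and negative parts of its real and imaginary
parts. -/
theorem exists_mem_span_indicator_norm_sub_le {X : Type*} {𝓢 : Set (Set X)} {f : X → ℂ} {M : ℝ}
    (hM : ∀ x, ‖f x‖ ≤ M)
    (h𝓢 : ∀ L : ℂ →L[ℝ] ℝ, ‖L‖ ≤ 1 → ∀ c, 0 < c → {x | c < L (f x)} ∈ 𝓢) {ε : ℝ} (hε : 0 < ε) :
    ∃ g ∈ Submodule.span ℂ ((fun s : Set X => s.indicator (1 : X → ℂ)) '' 𝓢),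
      ∀ x, ‖f x - g x‖ ≤ ε := by
  have part (L : ℂ →L[ℝ] ℝ) (hL : ‖L‖ ≤ 1) :
      ∃ g ∈ Submodule.span ℂ ((fun s : Set X => s.indicator (1 : X → ℂ)) '' 𝓢),
        ∀ x, ‖((max (L (f x)) 0 : ℝ) : ℂ) - g x‖ ≤ ε / 4 := by
    refine exists_mem_span_indicator_norm_sub_le_of_nonneg (fun x => le_max_right _ _) (M := M)
      (fun x => max_le ?_ ((norm_nonneg _).trans (hM x))) (fun c hc => ?_) (by positivity)
    · calc L (f x) ≤ ‖L (f x)‖ := le_abs_self _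
        _ ≤ ‖L‖ * ‖f x‖ := L.le_opNorm _
        _ ≤ 1 * ‖f x‖ := by gcongr
        _ ≤ M := by rw [one_mul]; exact hM x
    -- At a positive level, `L ∘ f` and its positive part have the same upper level set.
    · simpa [hc.not_gt] using h𝓢 L hL c hc
  obtain ⟨g₁, hg₁, h₁⟩ := part Complex.reCLM (by simp)
  obtain ⟨g₂, hg₂, h₂⟩ := part (-Complex.reCLM) (by simp)
  obtain ⟨g₃, hg₃, h₃⟩ := part Complex.imCLM (by simp)
  obtain ⟨g₄, hg₄, h₄⟩ := part (-Complex.imCLM) (by simp)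
  refine ⟨(g₁ - g₂) + Complex.I • (g₃ - g₄), Submodule.add_mem _ (Submodule.sub_mem _ hg₁ hg₂)
    (Submodule.smul_mem _ _ (Submodule.sub_mem _ hg₃ hg₄)), fun x => ?_⟩
  have hmax (a : ℝ) : a = max a 0 - max (-a) 0 := by
    rcases le_total a 0 with h | h
    · rw [max_eq_right h, max_eq_left (by linarith)]; ring
    · rw [max_eq_left h, max_eq_right (by linarith)]; ring
  have hf : f x = ((max (f x).re 0 : ℝ) - (max (-(f x).re) 0 : ℝ)) +
      Complex.I * ((max (f x).im 0 : ℝ) - (max (-(f x).im) 0 : ℝ)) := by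
    rw [← Complex.ofReal_sub, ← Complex.ofReal_sub, ← hmax, ← hmax, mul_comm, Complex.re_add_im]
  have h₁ := h₁ x
  have h₂ := h₂ x
  have h₃ := h₃ x
  have h₄ := h₄ x
  simp only [Complex.reCLM_apply, Complex.imCLM_apply, neg_apply]
    at h₁ h₂ h₃ h₄
  generalize ((max (f x).re 0 : ℝ) : ℂ) = a₁ at *
  generalize ((max (-(f x).re) 0 : ℝ) : ℂ) = a₂ at *
  generalize ((max (f x).im 0 : ℝ) : ℂ) = a₃ at *
  generalize ((max (-(f x).im) 0 : ℝ) : ℂ) = a₄ at *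
  rw [hf]
  calc ‖a₁ - a₂ + Complex.I * (a₃ - a₄) - ((g₁ - g₂) + Complex.I • (g₃ - g₄)) x‖
      = ‖((a₁ - g₁ x) - (a₂ - g₂ x)) + Complex.I * ((a₃ - g₃ x) - (a₄ - g₄ x))‖ := by
        congr 1
        simp only [Pi.add_apply, Pi.sub_apply, Pi.smul_apply, smul_eq_mul]
        ring
    _ ≤ (‖a₁ - g₁ x‖ + ‖a₂ - g₂ x‖) + (‖a₃ - g₃ x‖ + ‖a₄ - g₄ x‖) := by
        refine (norm_add_le _ _).trans (add_le_add (norm_sub_le _ _) ?_)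
        rw [norm_mul, Complex.norm_I, one_mul]
        exact norm_sub_le _ _
    _ ≤ ε := by linarith

/-- Induction for uniform limits of linear combinations of indicators of sets in a family `𝓢`. -/
theorem boundedMeasurable_induction_of_levelSets {X : Type*} [MeasurableSpace X]
    {p : boundedMeasurable X → Prop} {𝓢 : Set (Set X)} (hm : ∀ s ∈ 𝓢, MeasurableSet s) (zero : p 0)
    (indicator : ∀ s (hs : s ∈ 𝓢), p ⟨s.indicator 1, indicator_mem_boundedMeasurable (hm s hs)⟩)
    (add : ∀ f g, p f → p g → p (f + g)) (smul : ∀ (c : ℂ) f, p f → p (c • f))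
    (lim : ∀ f : boundedMeasurable X,
      (∀ ε > 0, ∃ g, p g ∧ ∀ x, ‖(f : X → ℂ) x - (g : X → ℂ) x‖ ≤ ε) → p f)
    (f : boundedMeasurable X)
    (h𝓢 : ∀ L : ℂ →L[ℝ] ℝ, ‖L‖ ≤ 1 → ∀ c, 0 < c → {x | c < L ((f : X → ℂ) x)} ∈ 𝓢) : p f := by
  have hspan : ∀ g ∈ Submodule.span ℂ ((fun s : Set X => s.indicator (1 : X → ℂ)) '' 𝓢),
      ∃ hg : g ∈ boundedMeasurable X, p ⟨g, hg⟩ := by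
    intro g hg
    induction hg using Submodule.span_induction with
    | mem g hg =>
      obtain ⟨s, hs, rfl⟩ := hg
      exact ⟨_, indicator s hs⟩
    | zero => exact ⟨_, zero⟩
    | add f g _ _ hf hg =>
      obtain ⟨hf, hpf⟩ := hf
      obtain ⟨hg, hpg⟩ := hg
      exact ⟨_, add ⟨f, hf⟩ ⟨g, hg⟩ hpf hpg⟩
    | smul c f _ hf =>
      obtain ⟨hf, hpf⟩ := hf
      exact ⟨_, smul c ⟨f, hf⟩ hpf⟩
  refine lim f fun ε hε => ?_
  obtain ⟨M, hM⟩ := f.2.2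
  obtain ⟨g, hg, hfg⟩ := exists_mem_span_indicator_norm_sub_le hM h𝓢 hε
  obtain ⟨hgm, hpg⟩ := hspan g hg
  exact ⟨⟨g, hgm⟩, hpg, hfg⟩

theorem boundedMeasurable_induction {X : Type*} [MeasurableSpace X] {p : boundedMeasurable X → Prop}
    (indicator : ∀ s (hs : MeasurableSet s),
      p ⟨s.indicator 1, indicator_mem_boundedMeasurable hs⟩)
    (add : ∀ f g, p f → p g → p (f + g)) (smul : ∀ (c : ℂ) f, p f → p (c • f))
    (lim : ∀ f : boundedMeasurable X,
      (∀ ε > 0, ∃ g, p g ∧ ∀ x, ‖(f : X → ℂ) x - (g : X → ℂ) x‖ ≤ ε) → p f)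
    (f : boundedMeasurable X) : p f := by
  refine boundedMeasurable_induction_of_levelSets (𝓢 := {s | MeasurableSet s}) (fun _ hs => hs)
    ?_ indicator add smul lim f
    fun L _ c _ => measurableSet_lt measurable_const (L.continuous.measurable.comp f.2.1)
  simpa using smul 0 _ (indicator ∅ MeasurableSet.empty)

/-! ### Integration with respect to a positive operator-valued measure -/

namespace POVM

variable {X : Type*} [MeasurableSpace X] {H : Type*} [NormedAddCommGroup H]
  [InnerProductSpace ℂ H] (A : POVM X H)

/-- Monotonicity: `A(X) = A(s) + A(sᶜ)` with `A(sᶜ)` positive. -/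
theorem re_inner_apply_le (v : H) {s : Set X} (hs : MeasurableSet s) :
    (⟪v, A s v⟫_ℂ).re ≤ ‖A Set.univ‖ * ‖v‖ ^ 2 := by
  have h1 : ⟪v, A Set.univ v⟫_ℂ = ⟪v, A s v⟫_ℂ + ⟪v, A sᶜ v⟫_ℂ := by
    have := (A.complexMeasure v v).of_union disjoint_compl_right hs hs.compl
    rwa [Set.union_compl_self] at this
  have h2 : 0 ≤ (⟪v, A sᶜ v⟫_ℂ).re := (A.isPositive _ hs.compl).re_inner_nonneg_right v
  calc (⟪v, A s v⟫_ℂ).re ≤ (⟪v, A Set.univ v⟫_ℂ).re := by rw [h1, Complex.add_re]; linarith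
    _ ≤ ‖⟪v, A Set.univ v⟫_ℂ‖ := Complex.re_le_norm _
    _ ≤ ‖v‖ * ‖A Set.univ v‖ := norm_inner_le_norm _ _
    _ ≤ ‖v‖ * (‖A Set.univ‖ * ‖v‖) := by gcongr; exact (A Set.univ).le_opNorm v
    _ = ‖A Set.univ‖ * ‖v‖ ^ 2 := by ring

section

variable {A} {f g : X → ℂ} {S T : H →L[ℂ] H}

theorem IsIntegral.add (hf : A.IsIntegral f T) (hg : A.IsIntegral g S) :
    A.IsIntegral (f + g) (T + S) := fun v w =>
  ⟨(hf v w).1.add (hg v w).1, by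
    rw [VectorMeasure.integral_add (hf v w).1 (hg v w).1, ← (hf v w).2, ← (hg v w).2,
      add_apply, inner_add_right]⟩

theorem IsIntegral.sub (hf : A.IsIntegral f T) (hg : A.IsIntegral g S) :
    A.IsIntegral (f - g) (T - S) := fun v w =>
  ⟨(hf v w).1.sub (hg v w).1, by
    rw [VectorMeasure.integral_sub (hf v w).1 (hg v w).1, ← (hf v w).2, ← (hg v w).2,
      sub_apply, inner_sub_right]⟩

theorem IsIntegral.smul (hf : A.IsIntegral f T) (c : ℂ) : A.IsIntegral (c • f) (c • T) := fun v w =>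
  ⟨(hf v w).1.smul c, by
    -- The pairing is only `ℝ`-bilinear; complex homogeneity comes from the set function, where it
    -- is associativity of multiplication.
    rw [VectorMeasure.integral_eq_setToFun, setToFun_smul _ _ c f,
      ← VectorMeasure.integral_eq_setToFun, ← (hf v w).2, smul_apply,
      inner_smul_right, smul_eq_mul]
    intro a s x
    exact mul_assoc _ _ _⟩

theorem IsIntegral.unique (hT : A.IsIntegral f T) (hS : A.IsIntegral f S) : T = S := by
  ext v
  exact ext_inner_left ℂ fun w => (hT v w).2.trans (hS v w).2.symm

end

variable [CompleteSpace H]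

/-- On a finite partition, `norm_inner_le` replaces each term by diagonal ones. These add up to the
form of `A` on the union, hence are controlled by `A(X)`. -/
theorem variation_univ_le (v w : H) : (A.complexMeasure v w).variation Set.univ ≤
    ENNReal.ofReal (‖A Set.univ‖ * ((‖v‖ ^ 2 + ‖w‖ ^ 2) / 2)) := by
  refine le_of_forall_lt fun a ha => ?_
  obtain ⟨P, -, hPd, hPm, hP⟩ :=
    (A.complexMeasure v w).exists_lt_sum_of_lt_variation MeasurableSet.univ ha
  refine hP.trans_le ?_
  have hsum (u : H) : ∑ p ∈ P, (⟪u, A p u⟫_ℂ).re ≤ ‖A Set.univ‖ * ‖u‖ ^ 2 := by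
    have h := (A.complexMeasure u u).of_biUnion_finset (f := id) hPd hPm
    rw [← Complex.re_sum]
    refine le_of_eq_of_le (congrArg Complex.re h.symm) ?_
    exact A.re_inner_apply_le u (Finset.measurableSet_biUnion P hPm)
  calc ∑ p ∈ P, ‖A.complexMeasure v w p‖ₑ
      = ENNReal.ofReal (∑ p ∈ P, ‖⟪w, A p v⟫_ℂ‖) := by
        rw [ENNReal.ofReal_sum_of_nonneg fun _ _ => norm_nonneg _]
        exact Finset.sum_congr rfl fun p _ => (ofReal_norm _).symm
    _ ≤ ENNReal.ofReal (∑ p ∈ P, ((⟪v, A p v⟫_ℂ).re + (⟪w, A p w⟫_ℂ).re) / 2) := by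
        refine ENNReal.ofReal_le_ofReal (Finset.sum_le_sum fun p hp => ?_)
        exact (A.isPositive p (hPm p hp)).norm_inner_le v w
    _ ≤ _ := by
        refine ENNReal.ofReal_le_ofReal ?_
        rw [← Finset.sum_div, Finset.sum_add_distrib]
        linarith [hsum v, hsum w]

instance (v w : H) : IsFiniteMeasure (A.complexMeasure v w).variation :=
  ⟨(A.variation_univ_le v w).trans_lt ENNReal.ofReal_lt_top⟩

theorem integrable_complexMeasure {f : X → ℂ} (hf : f ∈ boundedMeasurable X) (v w : H) :
    (A.complexMeasure v w).Integrable f :=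
  Integrable.of_bound hf.1.aestronglyMeasurable hf.2.choose (ae_of_all _ hf.2.choose_spec)

theorem norm_integral_complexMeasure_le {f : X → ℂ} {C : ℝ} (hC : 0 ≤ C) (hf : ∀ x, ‖f x‖ ≤ C)
    (v w : H) : ‖(A.complexMeasure v w).integral f (ContinuousLinearMap.mul ℝ ℂ)‖ ≤
      C * ‖A Set.univ‖ * ((‖v‖ ^ 2 + ‖w‖ ^ 2) / 2) := by
  refine (VectorMeasure.norm_integral_le_of_norm_le_const (ae_of_all _ hf)).trans ?_
  rw [ContinuousLinearMap.opNorm_mul, mul_one, mul_assoc]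
  gcongr
  exact ENNReal.toReal_le_of_le_ofReal (by positivity) (A.variation_univ_le v w)

variable {A} {f : X → ℂ} {T : H →L[ℂ] H}

theorem isIntegral_indicator (A : POVM X H) {s : Set X} (hs : MeasurableSet s) :
    A.IsIntegral (s.indicator 1) (A s) := fun v w =>
  ⟨A.integrable_complexMeasure (indicator_mem_boundedMeasurable hs) v w, by
    have := VectorMeasure.integral_indicator_const (μ := A.complexMeasure v w)
      (B := ContinuousLinearMap.mul ℝ ℂ) (1 : ℂ) hs
    rw [ContinuousLinearMap.mul_apply', one_mul] at this
    exact this.symm⟩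

/-- The estimate behind all the limit arguments below. -/
theorem IsIntegral.norm_le (hf : A.IsIntegral f T) {C : ℝ} (hC : 0 ≤ C) (h : ∀ x, ‖f x‖ ≤ C) :
    ‖T‖ ≤ C * ‖A Set.univ‖ :=
  ContinuousLinearMap.opNorm_le_of_norm_inner_le (by positivity) fun v w => by
    rw [(hf v w).2]
    exact A.norm_integral_complexMeasure_le hC h v w

theorem exists_isIntegral_of_approx (f : boundedMeasurable X)
    (h : ∀ ε > 0, ∃ g : boundedMeasurable X, (∃ T, A.IsIntegral g T) ∧
      ∀ x, ‖(f : X → ℂ) x - (g : X → ℂ) x‖ ≤ ε) :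
    ∃ T, A.IsIntegral f T := by
  obtain ⟨f, hf⟩ := f
  have hpos (n : ℕ) : (0 : ℝ) < 1 / (n + 1) := Nat.one_div_pos_of_nat
  choose g hgT hfg using fun n : ℕ => h (1 / (n + 1)) (hpos n)
  choose T hT using hgT
  have h0 : Tendsto (fun n : ℕ => (1 : ℝ) / (n + 1)) atTop (𝓝 0) :=
    tendsto_one_div_add_atTop_nhds_zero_nat
  have hcauchy : CauchySeq T := by
    -- The factor `2` comes from comparing `g n` and `g m` through `f`.
    refine cauchySeq_of_le_tendsto_0 (fun n : ℕ => 2 * (1 / ((n : ℝ) + 1)) * ‖A Set.univ‖) ?_ ?_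
    · intro n m N hn hm
      rw [dist_eq_norm]
      refine ((hT n).sub (hT m)).norm_le (by positivity) fun x => ?_
      have hle (k : ℕ) (hk : N ≤ k) : ‖f x - (g k : X → ℂ) x‖ ≤ 1 / ((N : ℝ) + 1) :=
        (hfg k x).trans (one_div_le_one_div_of_le (by positivity) (by gcongr))
      rw [Pi.sub_apply, ← sub_sub_sub_cancel_left _ _ (f x)]
      refine (norm_sub_le _ _).trans ?_
      linarith [hle n hn, hle m hm]
    · simpa using (h0.const_mul 2).mul_const ‖A Set.univ‖
  obtain ⟨S, hS⟩ := cauchySeq_tendsto_of_complete hcauchy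
  refine ⟨S, fun v w => ⟨A.integrable_complexMeasure hf v w, ?_⟩⟩
  have h1 : Tendsto (fun n => ⟪w, T n v⟫_ℂ) atTop (𝓝 ⟪w, S v⟫_ℂ) :=
    tendsto_const_nhds.inner (((ContinuousLinearMap.apply ℂ H v).continuous.tendsto S).comp hS)
  refine tendsto_nhds_unique h1 (tendsto_iff_norm_sub_tendsto_zero.2 ?_)
  refine squeeze_zero (fun n => norm_nonneg _) (fun n => ?_)
    (g := fun n : ℕ => 1 / ((n : ℝ) + 1) * ‖A Set.univ‖ * ((‖v‖ ^ 2 + ‖w‖ ^ 2) / 2)) ?_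
  · rw [(hT n v w).2, ← VectorMeasure.integral_sub (hT n v w).1 (A.integrable_complexMeasure hf v w)]
    refine A.norm_integral_complexMeasure_le (hpos n).le (fun x => ?_) v w
    rw [Pi.sub_apply, norm_sub_rev]
    exact hfg n x
  · simpa using (h0.mul_const ‖A Set.univ‖).mul_const ((‖v‖ ^ 2 + ‖w‖ ^ 2) / 2)

theorem exists_isIntegral (A : POVM X H) (f : boundedMeasurable X) : ∃ T, A.IsIntegral f T := by
  refine boundedMeasurable_induction (p := fun f => ∃ T, A.IsIntegral f T)
    (fun s hs => ⟨A s, ?_⟩) ?_ ?_ exists_isIntegral_of_approx f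
  · exact A.isIntegral_indicator hs
  · rintro f g ⟨T, hT⟩ ⟨S, hS⟩
    exact ⟨_, hT.add hS⟩
  · rintro c f ⟨T, hT⟩
    exact ⟨_, hT.smul c⟩

/-- The operator `∫ f dA`, for bounded measurable `f`. -/
noncomputable def integral (A : POVM X H) : boundedMeasurable X →ₗ[ℂ] (H →L[ℂ] H) where
  toFun f := (A.exists_isIntegral f).choose
  map_add' f g := by
    have h : A.IsIntegral ((f + g : boundedMeasurable X) : X → ℂ) _ :=
      (A.exists_isIntegral f).choose_spec.add (A.exists_isIntegral g).choose_spec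
    exact (A.exists_isIntegral (f + g)).choose_spec.unique h
  map_smul' c f := by
    have h : A.IsIntegral (c • (f : X → ℂ)) _ :=
      (A.exists_isIntegral f).choose_spec.smul c
    exact (A.exists_isIntegral (c • f)).choose_spec.unique h

theorem isIntegral_integral (A : POVM X H) (f : boundedMeasurable X) :
    A.IsIntegral f (A.integral f) :=
  (A.exists_isIntegral f).choose_spec

theorem integral_indicator (A : POVM X H) {s : Set X} (hs : MeasurableSet s) :
    A.integral ⟨s.indicator 1, indicator_mem_boundedMeasurable hs⟩ = A s :=
  (A.isIntegral_integral _).unique (A.isIntegral_indicator hs)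

theorem norm_integral_le (A : POVM X H) (f : boundedMeasurable X) {C : ℝ} (hC : 0 ≤ C)
    (h : ∀ x, ‖(f : X → ℂ) x‖ ≤ C) : ‖A.integral f‖ ≤ C * ‖A Set.univ‖ :=
  (A.isIntegral_integral f).norm_le hC h

theorem norm_integral_sub_le (A : POVM X H) (f g : boundedMeasurable X) {C : ℝ} (hC : 0 ≤ C)
    (h : ∀ x, ‖(f : X → ℂ) x - (g : X → ℂ) x‖ ≤ C) :
    ‖A.integral f - A.integral g‖ ≤ C * ‖A Set.univ‖ := by
  rw [← map_sub]
  exact A.norm_integral_le _ hC h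

/-- A closed set of operators contains the integral of a function when it contains the integrals of
uniform approximations. -/
theorem integral_mem_of_approx (A : POVM X H) {F : Set (H →L[ℂ] H)} (hF : IsClosed F)
    (f : boundedMeasurable X)
    (h : ∀ ε > 0, ∃ g : boundedMeasurable X, A.integral g ∈ F ∧
      ∀ x, ‖(f : X → ℂ) x - (g : X → ℂ) x‖ ≤ ε) : A.integral f ∈ F := by
  rw [← hF.closure_eq, Metric.mem_closure_iff]
  intro ε hε
  obtain ⟨g, hg, hfg⟩ := h (ε / (‖A Set.univ‖ + 1)) (by positivity)
  refine ⟨_, hg, ?_⟩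
  rw [dist_eq_norm]
  refine (A.norm_integral_sub_le f g (by positivity) hfg).trans_lt ?_
  rw [div_mul_eq_mul_div, div_lt_iff₀ (by positivity)]
  nlinarith

/-- The level-set approximations have nonnegative coefficients, so their integrals are positive;
positive operators form a closed set. -/
theorem isPositive_integral (A : POVM X H) (f : boundedMeasurable X)
    (hf : ∀ x, 0 ≤ (f : X → ℂ) x) : (A.integral f).IsPositive := by
  refine A.integral_mem_of_approx ContinuousLinearMap.isClosed_setOf_isPositive f fun ε hε => ?_
  obtain ⟨C, hC⟩ := f.2.2
  obtain ⟨N, hN⟩ := exists_abs_sub_sum_indicator_le (f := fun x => ((f : X → ℂ) x).re)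
    (fun x => (Complex.le_def.1 (hf x)).1) (fun x => (Complex.re_le_norm _).trans (hC x)) hε
  have hm (k : ℕ) : MeasurableSet {y | ε * (k + 1 : ℕ) < ((f : X → ℂ) y).re} :=
    measurableSet_lt measurable_const (Complex.measurable_re.comp f.2.1)
  refine ⟨∑ k ∈ Finset.range N,
    (ε : ℂ) • ⟨_, indicator_mem_boundedMeasurable (hm k)⟩, ?_, fun x => ?_⟩
  · rw [Set.mem_ofPred_eq, map_sum]
    refine ContinuousLinearMap.isPositive_sum _ fun k _ => ?_
    rw [map_smul, A.integral_indicator (hm k)]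
    exact (A.isPositive _ (hm k)).smul_of_nonneg (Complex.zero_le_real.2 hε.le)
  · refine le_of_eq_of_le ?_ (hN x)
    have hre : (f : X → ℂ) x = (((f : X → ℂ) x).re : ℂ) :=
      Complex.ext rfl (Complex.le_def.1 (hf x)).2.symm
    rw [← Real.norm_eq_abs, ← Complex.norm_real, hre]
    congr 1
    rw [Complex.ofReal_sub, Complex.ofReal_sum, AddSubmonoidClass.coe_finsetSum, Finset.sum_apply]
    congr 1
    refine Finset.sum_congr rfl fun k _ => ?_
    rw [Complex.ofReal_mul, Complex.ofReal_indicator_one]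
    rfl

theorem integral_star (A : POVM X H) (f : boundedMeasurable X) :
    A.integral ⟨star (f : X → ℂ), star_mem_boundedMeasurable f.2⟩ = star (A.integral f) := by
  refine boundedMeasurable_induction (p := fun f : boundedMeasurable X =>
    A.integral ⟨star (f : X → ℂ), star_mem_boundedMeasurable f.2⟩ = star (A.integral f))
    (fun s hs => ?_) (fun f g hf hg => ?_) (fun c f hf => ?_) (fun f h => ?_) f
  · rw [integral_indicator A hs, (A.isPositive s hs).isSelfAdjoint.star_eq, ← A.integral_indicator hs]
    congr 2
    ext x
    by_cases hx : x ∈ s <;> simp [hx]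
  · rw [map_add, star_add, ← hf, ← hg, ← map_add]
    congr 2
    exact star_add _ _
  · rw [map_smul, star_smul, ← hf, ← map_smul]
    congr 2
    exact star_smul _ _
  · refine eq_of_forall_dist_le fun ε hε => ?_
    obtain ⟨g, hg, hfg⟩ := h (ε / (2 * (‖A Set.univ‖ + 1))) (by positivity)
    have h1 := A.norm_integral_sub_le f g (by positivity) hfg
    have hfg' (x : X) : ‖star (f : X → ℂ) x - star (g : X → ℂ) x‖ ≤
        ε / (2 * (‖A Set.univ‖ + 1)) := by
      rw [Pi.star_apply, Pi.star_apply, ← star_sub, norm_star]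
      exact hfg x
    have h2 := A.norm_integral_sub_le ⟨star (f : X → ℂ), star_mem_boundedMeasurable f.2⟩
      ⟨star (g : X → ℂ), star_mem_boundedMeasurable g.2⟩ (by positivity) hfg'
    rw [hg] at h2
    have h3 : ε / (2 * (‖A Set.univ‖ + 1)) * ‖A Set.univ‖ ≤ ε / 2 := by
      rw [div_mul_eq_mul_div, div_le_div_iff₀ (by positivity) two_pos]
      nlinarith
    rw [← norm_star, star_sub] at h1
    rw [dist_eq_norm, ← sub_add_sub_cancel _ (star (A.integral g))]
    rw [norm_sub_rev] at h1
    linarith [norm_add_le (A.integral ⟨star (f : X → ℂ), star_mem_boundedMeasurable f.2⟩ -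
      star (A.integral g)) (star (A.integral g) - star (A.integral f))]

end POVM

/-! ### Families of positive operator-valued measures -/

theorem tendsto_zero_of_norm_sub_le {ι E : Type*} [SeminormedAddCommGroup E] {l : Filter ι}
    {F : ι → E} (h : ∀ ε > 0, ∃ G : ι → E, Tendsto G l (𝓝 0) ∧ ∀ i, ‖F i - G i‖ ≤ ε) :
    Tendsto F l (𝓝 0) := by
  refine Metric.tendsto_nhds.2 fun ε hε => ?_
  obtain ⟨G, hG, hFG⟩ := h (ε / 2) (half_pos hε)
  filter_upwards [Metric.tendsto_nhds.1 hG (ε / 2) (half_pos hε)] with i hi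
  rw [dist_zero_right] at hi ⊢
  linarith [hFG i, norm_le_norm_add_norm_sub' (F i) (G i)]

theorem tendsto_sub_mul_of_approx {ι R : Type*} [NonUnitalSeminormedRing R] {l : Filter ι}
    {P S T : ι → R} {D : ℝ} (hS : ∀ i, ‖S i‖ ≤ D) (hT : ∀ i, ‖T i‖ ≤ D)
    (h : ∀ ε > 0, ∃ P' S' T' : ι → R, Tendsto (fun i => P' i - S' i * T' i) l (𝓝 0) ∧
      ∀ i, ‖P i - P' i‖ ≤ ε ∧ ‖S i - S' i‖ ≤ ε ∧ ‖T i - T' i‖ ≤ ε) :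
    Tendsto (fun i => P i - S i * T i) l (𝓝 0) := by
  refine tendsto_zero_of_norm_sub_le fun ε hε => ?_
  -- The `1` keeps `‖T'‖ ≤ |D| + 1`; the three errors then carry total weight `1 + |D| + (|D| + 1) =
  -- 2|D| + 2`.
  obtain ⟨P', S', T', hlim, happrox⟩ := h (min 1 (ε / (2 * |D| + 2))) (by positivity)
  refine ⟨_, hlim, fun i => ?_⟩
  obtain ⟨h1, h2, h3⟩ := happrox i
  have hT' : ‖T' i‖ ≤ |D| + 1 := by
    have := norm_le_norm_add_norm_sub (T i) (T' i)
    linarith [hT i, le_abs_self D, h3.trans (min_le_left _ _)]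
  replace h1 := h1.trans (min_le_right _ _)
  replace h2 := h2.trans (min_le_right _ _)
  replace h3 := h3.trans (min_le_right _ _)
  calc ‖P i - S i * T i - (P' i - S' i * T' i)‖
      = ‖(P i - P' i) - (S i * (T i - T' i) + (S i - S' i) * T' i)‖ := by
        rw [sub_mul, mul_sub]; congr 1; abel
    _ ≤ ‖P i - P' i‖ + (‖S i‖ * ‖T i - T' i‖ + ‖S i - S' i‖ * ‖T' i‖) :=
        (norm_sub_le _ _).trans (add_le_add le_rfl ((norm_add_le _ _).trans
          (add_le_add (norm_mul_le _ _) (norm_mul_le _ _))))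
    _ ≤ ε / (2 * |D| + 2) + (|D| * (ε / (2 * |D| + 2)) + ε / (2 * |D| + 2) * (|D| + 1)) := by
        gcongr
        exact (hS i).trans (le_abs_self D)
    _ = ε := by field_simp; ring

/-- The upper limit gives a bound near `ħ = 0`; on the remaining compact interval `[ε, 1]` norm
continuity does. -/
theorem IsFullAsymptoticSpectralMeasure.exists_norm_univ_le {X : Type*} [MeasurableSpace X]
    {H : Type*} [NormedAddCommGroup H] [InnerProductSpace ℂ H] {A : HBar → POVM X H}
    (hA : IsFullAsymptoticSpectralMeasure A) : ∃ C, ∀ h, ‖A h Set.univ‖ ≤ C := by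
  have hlt : limsup (fun h => ‖A h Set.univ‖ₑ) classicalLimit < 2 :=
    hA.limsup_le.trans_lt ENNReal.one_lt_two
  have hev : ∀ᶠ h : HBar in comap ((↑) : HBar → ℝ) (𝓝 0), ‖A h Set.univ‖ₑ < 2 :=
    eventually_lt_of_limsup_lt hlt
  rw [eventually_comap, Metric.eventually_nhds_iff] at hev
  obtain ⟨ε, hε, hsmall⟩ := hev
  have hK : IsCompact (((↑) : HBar → ℝ) ⁻¹' Set.Icc ε 1) := by
    refine Topology.IsInducing.subtypeVal.isCompact_preimage' isCompact_Icc fun x hx => ?_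
    rw [Subtype.range_coe]
    exact ⟨hε.trans_le hx.1, hx.2⟩
  obtain ⟨C, hC⟩ := hK.exists_bound_of_continuousOn
    (hA.continuous Set.univ MeasurableSet.univ).continuousOn
  refine ⟨max C 2, fun h => ?_⟩
  rcases lt_or_ge (h : ℝ) ε with hh | hh
  · have h2 := hsmall (y := h) (by rwa [Real.dist_0_eq_abs, abs_of_pos h.2.1]) h rfl
    refine le_max_of_le_right ?_
    rw [← ofReal_norm, ← ENNReal.ofReal_ofNat, ENNReal.ofReal_lt_ofReal_iff two_pos] at h2
    exact h2.le
  · exact le_max_of_le_left (hC h ⟨hh, h.2.2⟩)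

namespace POVM

variable {X : Type*} [MeasurableSpace X] {H : Type*} [NormedAddCommGroup H]
  [InnerProductSpace ℂ H] [CompleteSpace H]

/-- One approximation `f'` serves all `ħ`, both alone and multiplied by the fixed factor `g`. -/
theorem exists_norm_integral_sub_le {A : HBar → POVM X H} {C : ℝ}
    (hC : ∀ h, ‖A h Set.univ‖ ≤ C) {f : boundedMeasurable X} {p : boundedMeasurable X → Prop}
    (hf : ∀ ε > 0, ∃ f', p f' ∧ ∀ x, ‖(f : X → ℂ) x - (f' : X → ℂ) x‖ ≤ ε)
    (g : boundedMeasurable X) {ε : ℝ} (hε : 0 < ε) :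
    ∃ f', p f' ∧ ∀ h, ‖(A h).integral f - (A h).integral f'‖ ≤ ε ∧
      ‖(A h).integral (f * g) - (A h).integral (f' * g)‖ ≤ ε := by
  have hC0 : 0 ≤ C := (norm_nonneg _).trans (hC ⟨1, one_pos, le_rfl⟩)
  obtain ⟨M, hM⟩ := g.2.2
  obtain ⟨f', hf', hff'⟩ := hf (ε / ((C + 1) * (|M| + 1))) (by positivity)
  refine ⟨f', hf', fun h => ⟨((A h).norm_integral_sub_le f f' (by positivity) hff').trans ?_,
    ((A h).norm_integral_sub_le (f * g) (f' * g)
      (C := ε / ((C + 1) * (|M| + 1)) * |M|) (by positivity) fun x => ?_).trans ?_⟩⟩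
  · calc ε / ((C + 1) * (|M| + 1)) * ‖A h Set.univ‖
        ≤ ε / ((C + 1) * (|M| + 1)) * ((C + 1) * (|M| + 1)) := by
          gcongr
          nlinarith [hC h, abs_nonneg M]
      _ = ε := by field_simp
  · change ‖(f : X → ℂ) x * (g : X → ℂ) x - (f' : X → ℂ) x * (g : X → ℂ) x‖ ≤ _
    rw [← sub_mul, norm_mul]
    gcongr
    · exact hff' x
    · exact (hM x).trans (le_abs_self M)
  · calc ε / ((C + 1) * (|M| + 1)) * |M| * ‖A h Set.univ‖
        ≤ ε / ((C + 1) * (|M| + 1)) * (|M| + 1) * (C + 1) := by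
          gcongr
          · linarith
          · linarith [hC h]
      _ = ε := by field_simp

theorem continuous_integral {A : HBar → POVM X H} {C : ℝ} (hC : ∀ h, ‖A h Set.univ‖ ≤ C)
    (hA : ∀ s, MeasurableSet s → Continuous fun h => A h s) (f : boundedMeasurable X) :
    Continuous fun h => (A h).integral f := by
  refine boundedMeasurable_induction (p := fun f => Continuous fun h => (A h).integral f)
    (fun s hs => ?_) (fun f g hf hg => ?_) (fun c f hf => ?_) (fun f hf => ?_) f
  · simpa only [integral_indicator _ hs] using hA s hs
  · simp only [map_add]
    exact hf.add hg
  · simp only [map_smul]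
    exact hf.const_smul c
  · refine continuous_of_uniform_approx_of_continuous fun u hu => ?_
    obtain ⟨ε, hε, hu⟩ := Metric.mem_uniformity_dist.1 hu
    -- The factor `1` is a dummy: only the first of the two estimates is used.
    obtain ⟨g, hg, hfg⟩ := exists_norm_integral_sub_le hC hf 1 (half_pos hε)
    refine ⟨_, hg, fun h => hu ?_⟩
    rw [dist_eq_norm]
    exact (hfg h).1.trans_lt (half_lt_self hε)

theorem exists_norm_integral_le {A : HBar → POVM X H} {C : ℝ} (hC : ∀ h, ‖A h Set.univ‖ ≤ C)
    (f : boundedMeasurable X) : ∃ D, ∀ h, ‖(A h).integral f‖ ≤ D := by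
  obtain ⟨M, hM⟩ := f.2.2
  refine ⟨|M| * C, fun h => ?_⟩
  refine ((A h).norm_integral_le f (abs_nonneg M) fun x => (hM x).trans (le_abs_self M)).trans ?_
  gcongr
  exact hC h

/-! ### Asymptotic multiplicativity, one factor at a time. -/

theorem tendsto_integral_mul_sub_mul_of_approx {A : HBar → POVM X H} {C : ℝ}
    (hC : ∀ h, ‖A h Set.univ‖ ≤ C) {l : Filter HBar} {f g : boundedMeasurable X}
    (hf : ∀ ε > 0, ∃ f' : boundedMeasurable X,
      Tendsto (fun h => (A h).integral (f' * g) - (A h).integral f' * (A h).integral g) l (𝓝 0) ∧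
        ∀ x, ‖(f : X → ℂ) x - (f' : X → ℂ) x‖ ≤ ε) :
    Tendsto (fun h => (A h).integral (f * g) - (A h).integral f * (A h).integral g) l (𝓝 0) := by
  obtain ⟨D, hD⟩ := exists_norm_integral_le hC f
  obtain ⟨E, hE⟩ := exists_norm_integral_le hC g
  refine tendsto_sub_mul_of_approx (fun h => (hD h).trans (le_max_left D E))
    (fun h => (hE h).trans (le_max_right D E)) fun ε hε => ?_
  obtain ⟨f', hf', hff'⟩ := exists_norm_integral_sub_le hC hf g hε
  exact ⟨_, _, _, hf', fun h => ⟨(hff' h).2, (hff' h).1, by simpa using hε.le⟩⟩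

theorem tendsto_integral_mul_sub_mul_of_approx_right {A : HBar → POVM X H} {C : ℝ}
    (hC : ∀ h, ‖A h Set.univ‖ ≤ C) {l : Filter HBar} {f g : boundedMeasurable X}
    (hg : ∀ ε > 0, ∃ g' : boundedMeasurable X,
      Tendsto (fun h => (A h).integral (f * g') - (A h).integral f * (A h).integral g') l (𝓝 0) ∧
        ∀ x, ‖(g : X → ℂ) x - (g' : X → ℂ) x‖ ≤ ε) :
    Tendsto (fun h => (A h).integral (f * g) - (A h).integral f * (A h).integral g) l (𝓝 0) := by
  obtain ⟨D, hD⟩ := exists_norm_integral_le hC f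
  obtain ⟨E, hE⟩ := exists_norm_integral_le hC g
  refine tendsto_sub_mul_of_approx (fun h => (hD h).trans (le_max_left D E))
    (fun h => (hE h).trans (le_max_right D E)) fun ε hε => ?_
  obtain ⟨g', hg', hgg'⟩ := exists_norm_integral_sub_le hC hg f hε
  refine ⟨_, _, _, hg', fun h => ⟨?_, by simpa using hε.le, (hgg' h).1⟩⟩
  -- The functions commute although the operators need not, so the approximation lemma for left
  -- factors applies.
  rw [mul_comm f, mul_comm f]
  exact (hgg' h).2

theorem integral_indicator_mul_indicator (A : POVM X H) {s t : Set X} (hs : MeasurableSet s)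
    (ht : MeasurableSet t) :
    A.integral (⟨s.indicator 1, indicator_mem_boundedMeasurable hs⟩ *
      ⟨t.indicator 1, indicator_mem_boundedMeasurable ht⟩) = A (s ∩ t) := by
  rw [← A.integral_indicator (hs.inter ht)]
  congr 1
  exact Subtype.ext Set.inter_indicator_one.symm

theorem tendsto_integral_mul_sub_mul_of_indicator_right {A : HBar → POVM X H} {C : ℝ}
    (hC : ∀ h, ‖A h Set.univ‖ ≤ C) {l : Filter HBar} {f : boundedMeasurable X}
    (hf : ∀ t (ht : MeasurableSet t), Tendsto (fun h =>
      (A h).integral (f * ⟨t.indicator 1, indicator_mem_boundedMeasurable ht⟩) -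
        (A h).integral f * A h t) l (𝓝 0)) (g : boundedMeasurable X) :
    Tendsto (fun h => (A h).integral (f * g) - (A h).integral f * (A h).integral g) l (𝓝 0) := by
  refine boundedMeasurable_induction (p := fun g => Tendsto (fun h =>
      (A h).integral (f * g) - (A h).integral f * (A h).integral g) l (𝓝 0))
    (fun t ht => ?_) (fun g₁ g₂ h₁ h₂ => ?_) (fun c g hg => ?_)
    (fun g hg => tendsto_integral_mul_sub_mul_of_approx_right hC hg) g
  · refine (hf t ht).congr fun h => ?_
    rw [integral_indicator _ ht]
  · have := h₁.add h₂
    rw [add_zero] at this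
    refine this.congr fun h => ?_
    rw [mul_add, map_add, map_add, mul_add]
    abel
  · have := hg.const_smul c
    rw [smul_zero] at this
    refine this.congr fun h => ?_
    rw [mul_smul_comm, map_smul, map_smul, mul_smul_comm, smul_sub]

/-- The defect is bilinear in `(f, g)`. Induction on `f` reduces to an indicator on the left,
induction on `g` to two indicators, where the defect is that of the measures. -/
theorem tendsto_integral_mul_sub_mul {A : HBar → POVM X H} {C : ℝ}
    (hC : ∀ h, ‖A h Set.univ‖ ≤ C) {l : Filter HBar}
    (hA : ∀ s t, MeasurableSet s → MeasurableSet t →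
      Tendsto (fun h => A h (s ∩ t) - A h s * A h t) l (𝓝 0)) (f g : boundedMeasurable X) :
    Tendsto (fun h => (A h).integral (f * g) - (A h).integral f * (A h).integral g) l (𝓝 0) := by
  refine boundedMeasurable_induction (p := fun f => Tendsto (fun h =>
      (A h).integral (f * g) - (A h).integral f * (A h).integral g) l (𝓝 0))
    (fun s hs => ?_) (fun f₁ f₂ h₁ h₂ => ?_) (fun c f hf => ?_)
    (fun f hf => tendsto_integral_mul_sub_mul_of_approx hC hf) f
  · refine tendsto_integral_mul_sub_mul_of_indicator_right hC (fun t ht => ?_) g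
    refine (hA s t hs ht).congr fun h => ?_
    rw [integral_indicator_mul_indicator _ hs ht, integral_indicator _ hs]
  · have := h₁.add h₂
    rw [add_zero] at this
    refine this.congr fun h => ?_
    rw [add_mul, map_add, map_add, add_mul]
    abel
  · have := hf.const_smul c
    rw [smul_zero] at this
    refine this.congr fun h => ?_
    rw [smul_mul_assoc, map_smul, map_smul, smul_mul_assoc, smul_sub]

end POVM

/-! ### Values in the ideal, and the main theorem. -/

theorem POVM.IsLocallyValued.integral_mem {X : Type*} [TopologicalSpace X] [MeasurableSpace X]
    [OpensMeasurableSpace X] {H : Type*} [NormedAddCommGroup H] [InnerProductSpace ℂ H]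
    [CompleteSpace H] {A : POVM X H} {I : Ideal (H →L[ℂ] H)}
    (hA : A.IsLocallyValued (I : Set (H →L[ℂ] H))) (hI : IsClosed (I : Set (H →L[ℂ] H)))
    (f : X →ᵇ ℂ) (hf : Tendsto f (cocompact X) (𝓝 0)) :
    A.integral ⟨f, f.mem_boundedMeasurable⟩ ∈ I := by
  refine boundedMeasurable_induction_of_levelSets (p := fun f => A.integral f ∈ I)
    (𝓢 := {U | IsOpen U ∧ IsCompact (closure U)}) (fun U hU => hU.1.measurableSet) ?_
    (fun U hU => ?_) (fun f g hf hg => ?_) (fun c f hf => ?_)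
    (fun f hf => A.integral_mem_of_approx hI f hf) _ (fun L hL c hc => ?_)
  · rw [map_zero]
    exact zero_mem I
  · rw [A.integral_indicator hU.1.measurableSet]
    exact hA U hU.1 hU.2
  · rw [map_add]
    exact add_mem hf hg
  · rw [map_smul, ← smul_one_mul]
    exact I.mul_mem_left _ hf
  · refine ⟨isOpen_lt continuous_const (L.continuous.comp f.continuous), ?_⟩
    obtain ⟨K, hK, hKf⟩ := mem_cocompact.1 (hf (Metric.ball_mem_nhds 0 hc))
    have hcl : IsClosed {x | c ≤ L (f x)} :=
      isClosed_le continuous_const (L.continuous.comp f.continuous)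
    -- The closure lies in `{c ≤ L ∘ f}`, and this lies in `K`: outside `K`, `‖f‖ < c`, while `L f ≤
    -- ‖f‖`.
    refine (hK.of_isClosed_subset hcl fun x hx => ?_).of_isClosed_subset isClosed_closure
      (closure_minimal (fun x (hx : c < L (f x)) => hx.le) hcl)
    by_contra hxK
    have hlt : ‖f x‖ < c := by simpa using hKf hxK
    have hle : L (f x) ≤ 1 * ‖f x‖ := (le_abs_self _).trans (L.le_of_opNorm_le hL _)
    have hcx : c ≤ L (f x) := hx
    linarith

theorem corollary4p4 {X : Type*} [TopologicalSpace X] [T2Space X] [LocallyCompactSpace X]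
    [MeasurableSpace X] [BorelSpace X] {H : Type*} [NormedAddCommGroup H]
    [InnerProductSpace ℂ H] [CompleteSpace H]
    (I : Ideal (H →L[ℂ] H)) [I.IsTwoSided] (hI : IsClosed (I : Set (H →L[ℂ] H)))
    (A : HBar → POVM X H) (hA : IsFullAsymptoticSpectralMeasure A)
    (hAI : ∀ h, (A h).IsLocallyValued (I : Set (H →L[ℂ] H)))
    (δ : ContinuousCompactification X) :
    ∃ Q : HBar → δ.algebra →ₗ[ℂ] (H →L[ℂ] H),
      (∀ h (f : δ.algebra), (A h).IsIntegral (f : X →ᵇ ℂ) (Q h f)) ∧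
      (∀ h (f : δ.algebra) T, (A h).IsIntegral (f : X →ᵇ ℂ) T → T = Q h f) ∧
      (∀ h (f : δ.algebra), (∀ x, 0 ≤ (f : X →ᵇ ℂ) x) → (Q h f).IsPositive) ∧
      IsRelativeAsymptoticMorphism δ.zeroAtInftyIdeal I (fun h f => Q h f) := by
  obtain ⟨C, hC⟩ := hA.exists_norm_univ_le
  let toBdd : δ.algebra →ₗ[ℂ] boundedMeasurable X :=
    { toFun := fun f => ⟨(f : X →ᵇ ℂ), (f : X →ᵇ ℂ).mem_boundedMeasurable⟩
      map_add' := fun _ _ => rfl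
      map_smul' := fun _ _ => rfl }
  have hInt (h : HBar) (f : δ.algebra) :
      (A h).IsIntegral (f : X →ᵇ ℂ) ((A h).integral (toBdd f)) :=
    (A h).isIntegral_integral (toBdd f)
  refine ⟨fun h => (A h).integral ∘ₗ toBdd, hInt, fun h f T hT => hT.unique (hInt h f),
    fun h f hf => (A h).isPositive_integral (toBdd f) hf, ?_⟩
  refine
    { continuous := fun f => POVM.continuous_integral hC hA.continuous (toBdd f)
      bounded := fun f => POVM.exists_norm_integral_le hC (toBdd f)
      add := fun f g => by simp [tendsto_const_nhds]
      smul := fun c f => by simp [tendsto_const_nhds]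
      star := fun f => ?_
      mul := fun f g => ?_
      mapsTo := fun h f hf => (hAI h).integral_mem hI f hf }
  -- The adjoint defect is zero for every `ħ`.
  · refine tendsto_const_nhds.congr fun h => ?_
    rw [eq_comm, norm_eq_zero, sub_eq_zero]
    exact (A h).integral_star (toBdd f)
  · exact tendsto_zero_iff_norm_tendsto_zero.1 (POVM.tendsto_integral_mul_sub_mul hC
      (fun s t hs ht => tendsto_zero_iff_norm_tendsto_zero.2 (hA.projective s hs t ht))
      (toBdd f) (toBdd g))
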